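/- For a finite group $G$ and an element $\alpha=\sum_{g\in G}a_g g$ of the integral group ring $\mathbb Z[G]$, the group determinant of $\alpha$ is $D(\alpha)=\det\left(a_{gh^{-1}}\right)_{g,h\in G}$, where $g$ indexes the rows and $h$ the columns; the integer group determinants for $G$ are the values $D(\alpha)$, $\alpha\in\mathbb Z[G]$. Let $GA(1,7)$ be the general affine group of degree one over $\mathbb F_7$, that is, the group (of order 42) of all maps $x\mapsto ax+b$ of $\mathbb F_7$ with $a\in\mathbb F_7^*$, $b\in\mathbb F_7$, under composition. Theorem. The integer group determinants for $GA(1,7)$ are exactly the integers of the form $$ m(m+7\ell)^6,\qquad m,\ell\in\mathbb Z,\quad (m \text{ odd or } 4\mid m) \text{ and } (3\nmid m \text{ or } 9\mid m). $$ -/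

import Mathlib

/-- The general affine group `GA(1, p)` of degree one: the group, under composition, of the affine
bijections `x ↦ a * x + b` of the field with `p` elements. -/
abbrev GA (p : ℕ) : Type := ZMod p ≃ᵃ[ZMod p] ZMod p

noncomputable instance GA.instFintype (p : ℕ) [NeZero p] : Fintype (GA p) :=
  Fintype.ofInjective (fun e : GA p => e.toEquiv) AffineEquiv.toEquiv_injective

noncomputable instance GA.instDecidableEq (p : ℕ) : DecidableEq (GA p) := Classical.decEq _

/-- The group determinant of an element `∑ a_g g` of the integral group ring of a finite group:
the determinant of the matrix `(a_{g h⁻¹})` with rows indexed by `g` and columns by `h`. -/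
def groupDet {G : Type*} [Group G] [Fintype G] [DecidableEq G] (a : MonoidAlgebra ℤ G) : ℤ :=
  (Matrix.of fun g h : G => a.coeff (g * h⁻¹)).det

/-- The set of integer group determinants of a finite group. -/
def integerGroupDets (G : Type*) [Group G] [Fintype G] [DecidableEq G] : Set ℤ :=
  Set.range fun a : MonoidAlgebra ℤ G => groupDet a

/-! Over `ℚ` the regular representation of `GA p` splits into the regular representation of the
quotient `(ZMod p)ˣ` and `p - 1` copies of the augmentation part of the permutation representation.
Hence every group determinant is `m * N ^ (p - 1)`, with `m` a group determinant of `(ZMod p)ˣ` and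
`N = det (augRep c)` (`det_convMatrix`). Modulo `p` the augmentation part acts triangularly on
polynomial functions without constant term. Its diagonal runs through all characters `a ↦ a ^ i`, so
`N ≡ m` (`det_augRep_modEq`). For `p = 7` the conditions at 2 and 3 come from congruences between
the four rational factors of a `6 × 6` circulant determinant. Conversely, a rank-one change of
`augRep` that fixes `m` moves `N` by any multiple of `p` once a certain minor is a unit
(`exists_det_augRep_eq`). Six explicit elements cover all admissible `m`. -/

open Finset

variable {p : ℕ} [Fact p.Prime]

/-! ### Coordinates on the affine group -/

namespace GA

/-- The affine bijection `x ↦ a * x + b`. -/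
def affine (a : (ZMod p)ˣ) (b : ZMod p) : GA p where
  toFun x := a * x + b
  invFun x := ↑a⁻¹ * (x - b)
  left_inv x := by beta_reduce; rw [add_sub_cancel_right, Units.inv_mul_cancel_left]
  right_inv x := by beta_reduce; rw [Units.mul_inv_cancel_left, sub_add_cancel]
  linear := LinearEquiv.smulOfUnit a
  map_vadd' x v := by
    change a * (v + x) + b = a * v + (a * x + b)
    ring

theorem affine_apply (a : (ZMod p)ˣ) (b x : ZMod p) : affine a b x = a * x + b := rfl

theorem affine_mul (a a' : (ZMod p)ˣ) (b b' : ZMod p) :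
    affine a b * affine a' b' = affine (a * a') (b + a * b') := by
  ext x
  change affine a b (affine a' b' x) = _
  simp only [affine_apply, Units.val_mul]
  ring

theorem affine_mul_inv (a a' : (ZMod p)ˣ) (b b' : ZMod p) :
    affine a b * (affine a' b')⁻¹ = affine (a / a') (b - ↑(a / a') * b') := by
  rw [mul_inv_eq_iff_eq_mul, affine_mul]
  simp

theorem affine_bijective :
    Function.Bijective fun x : (ZMod p)ˣ × ZMod p => affine x.1 x.2 := by
  constructor
  · rintro ⟨a, b⟩ ⟨a', b'⟩ h
    have h0 : affine a b 0 = affine a' b' 0 := by simp only at h; rw [h]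
    have h1 : affine a b 1 = affine a' b' 1 := by simp only at h; rw [h]
    simp only [affine_apply, mul_zero, zero_add, mul_one] at h0 h1
    subst h0
    simp only [add_left_inj, Units.val_inj] at h1
    rw [h1]
  · intro e
    have key : ∀ x, e x = e.linear 1 * x + e 0 := by
      intro x
      have h := e.map_vadd 0 x
      have h2 := e.linear.map_smul x 1
      simp only [vadd_eq_add, add_zero, smul_eq_mul, mul_one] at h h2
      rw [h, h2, mul_comm]
    have hne : e.linear 1 ≠ 0 := by simp
    refine ⟨(Units.mk0 _ hne, e 0), ?_⟩
    ext x
    rw [key x]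
    rfl

/-- The group `GA p` in the coordinates `(a, b)` of the map `x ↦ a * x + b`. -/
noncomputable def coords : (ZMod p)ˣ × ZMod p ≃ GA p :=
  Equiv.ofBijective _ affine_bijective

theorem coords_mul_inv (g h : (ZMod p)ˣ × ZMod p) :
    coords g * (coords h)⁻¹ = coords (g.1 / h.1, g.2 - ↑(g.1 / h.1) * h.2) :=
  affine_mul_inv _ _ _ _

end GA

/-! ### Splitting of the regular representation -/

section Representations

variable {R : Type*} [CommRing R]

/-- The matrix of a convolution operator on `GA p` in the coordinates `GA.coords`. -/
def convMatrix (c : (ZMod p)ˣ → ZMod p → R) :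
    Matrix ((ZMod p)ˣ × ZMod p) ((ZMod p)ˣ × ZMod p) R :=
  .of fun g h => c (g.1 / h.1) (g.2 - ↑(g.1 / h.1) * h.2)

/-- The permutation representation of `GA p` on `ZMod p`, extended to the group ring. -/
def permRep (c : (ZMod p)ˣ → ZMod p → R) : Matrix (ZMod p) (ZMod p) R :=
  .of fun y x => ∑ a : (ZMod p)ˣ, c a (y - a * x)

/-- The `p - 1`-dimensional representation of `GA p` on vectors of `R ^ p` with coordinate sum zero,
in the basis `e_x - e_0`, extended to the group ring. -/
def augRep (c : (ZMod p)ˣ → ZMod p → R) : Matrix (ZMod p)ˣ (ZMod p)ˣ R :=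
  .of fun y x => permRep c y x - permRep c y 0

/-- The image of an element of the group ring of `GA p` in the group ring of `(ZMod p)ˣ`. -/
def dilationPart (c : (ZMod p)ˣ → ZMod p → R) (a : (ZMod p)ˣ) : R := ∑ b, c a b

/-- The group matrix of an element of the group ring of `(ZMod p)ˣ`. -/
def dilationMatrix (f : (ZMod p)ˣ → R) : Matrix (ZMod p)ˣ (ZMod p)ˣ R :=
  .of fun a a' => f (a / a')

theorem sum_units_add_zero (f : ZMod p → R) : ∑ u : (ZMod p)ˣ, f u + f 0 = ∑ x, f x := by
  rw [← Finset.sum_erase_add univ f (mem_univ 0)]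
  congr 1
  refine Finset.sum_bij (fun u _ => (u : ZMod p)) (by simp) (by simp [Units.val_inj])
    (fun b hb => ⟨Units.mk0 b (by simpa using hb), by simp, rfl⟩) (by simp)

/-- Convolution, in coordinates. -/
def conv (c v : (ZMod p)ˣ → ZMod p → R) (a : (ZMod p)ˣ) (b : ZMod p) : R :=
  ∑ a' : (ZMod p)ˣ, ∑ b', c (a / a') (b - ↑(a / a') * b') * v a' b'

theorem convMatrix_mulVec (c : (ZMod p)ˣ → ZMod p → R) (v : (ZMod p)ˣ × ZMod p → R) :
    (convMatrix c).mulVec v = fun g => conv c (fun a b => v (a, b)) g.1 g.2 := by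
  ext g
  simp [Matrix.mulVec, dotProduct, convMatrix, conv, Fintype.sum_prod_type]

theorem dilationPart_conv (c v : (ZMod p)ˣ → ZMod p → R) :
    dilationPart (conv c v) = (dilationMatrix (dilationPart c)).mulVec (dilationPart v) := by
  ext a
  simp only [dilationPart, conv, dilationMatrix, Matrix.mulVec, dotProduct, Matrix.of_apply]
  rw [Finset.sum_comm]
  refine Finset.sum_congr rfl fun a' _ => ?_
  rw [Finset.sum_comm, Finset.mul_sum]
  refine Finset.sum_congr rfl fun b' _ => ?_
  rw [← Finset.sum_mul]
  congr 1
  exact Fintype.sum_equiv (Equiv.subRight _) _ _ fun _ => rfl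

theorem permRep_conv (c v : (ZMod p)ˣ → ZMod p → R) :
    permRep (conv c v) = permRep c * permRep v := by
  ext y x
  simp only [permRep, conv, Matrix.mul_apply, Matrix.of_apply]
  rw [Finset.sum_comm]
  simp_rw [Finset.mul_sum]
  rw [Finset.sum_comm (s := (univ : Finset (ZMod p)))]
  refine Finset.sum_congr rfl fun a' _ => ?_
  rw [Finset.sum_comm]
  refine Fintype.sum_equiv (Equiv.addRight (↑a' * x)) _ _ fun b' => ?_
  simp only [Equiv.coe_addRight, add_sub_cancel_right]
  rw [← Finset.sum_mul]
  congr 1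
  refine Fintype.sum_equiv (Equiv.divRight a') _ _ fun a => ?_
  simp only [Equiv.divRight_apply]
  congr 1
  have : (a : ZMod p) = ↑(a / a') * ↑a' := by rw [← Units.val_mul, div_mul_cancel]
  rw [this]
  ring

theorem sum_permRep (c : (ZMod p)ˣ → ZMod p → R) (x : ZMod p) :
    ∑ y, permRep c y x = ∑ a, dilationPart c a := by
  simp only [permRep, dilationPart, Matrix.of_apply]
  rw [Finset.sum_comm]
  exact Finset.sum_congr rfl fun a _ => Fintype.sum_equiv (Equiv.subRight _) _ _ fun _ => rfl

theorem sum_augRep (c : (ZMod p)ˣ → ZMod p → R) (x : (ZMod p)ˣ) :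
    ∑ y, augRep c y x = permRep c 0 0 - permRep c 0 x := by
  have h := sum_units_add_zero fun y => permRep c y x - permRep c y 0
  have h' : ∑ y, (permRep c y x - permRep c y 0) = 0 := by
    rw [Finset.sum_sub_distrib, sum_permRep, sum_permRep, sub_self]
  rw [h'] at h
  simp only [augRep, Matrix.of_apply]
  linear_combination h

/-- Differences of columns of `permRep v` have coordinate sum zero, so the missing row `0` is
recovered from the others by `sum_augRep`. -/
theorem augRep_conv (c v : (ZMod p)ˣ → ZMod p → R) :
    augRep (conv c v) = augRep c * augRep v := by
  ext y x
  have h := sum_units_add_zero fun z => permRep c y z * (permRep v z x - permRep v z 0)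
  have h2 := sum_augRep v x
  have h3 : augRep (conv c v) y x = ∑ z, permRep c y z * (permRep v z x - permRep v z 0) := by
    simp [augRep, permRep_conv, Matrix.mul_apply, mul_sub]
  rw [h3, ← h, Matrix.mul_apply]
  have h4 : ∑ z, augRep c y z * augRep v z x =
      ∑ z : (ZMod p)ˣ, permRep c y z * (permRep v z x - permRep v z 0)
        - permRep c y 0 * ∑ z, augRep v z x := by
    rw [Finset.mul_sum, ← Finset.sum_sub_distrib]
    refine Finset.sum_congr rfl fun z _ => ?_
    simp only [augRep, Matrix.of_apply]
    ring
  rw [h4, h2]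
  ring

/-- Lines of different slopes meet in exactly one point, so each slope `a' ≠ a` contributes its full
sum, while slope `a` contributes only `c a b`, counted `p` times. This inversion formula recovers
`c` from `permRep c` and `dilationPart c`. -/
theorem sum_permRep_line (c : (ZMod p)ˣ → ZMod p → R) (a : (ZMod p)ˣ) (b : ZMod p) :
    ∑ x, permRep c (a * x + b) x = p * c a b + ∑ a', dilationPart c a' - dilationPart c a := by
  have h : ∀ a' : (ZMod p)ˣ, ∑ x : ZMod p, c a' (a * x + b - a' * x) =
      dilationPart c a' + if a' = a then p * c a b - dilationPart c a else 0 := by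
    intro a'
    split_ifs with haa
    · subst haa
      simp
    · have hne : (a : ZMod p) - a' ≠ 0 := by
        rw [sub_ne_zero]
        exact fun h => haa (Units.ext h.symm)
      rw [add_zero]
      refine Fintype.sum_equiv ((Equiv.mulLeft₀ _ hne).trans (Equiv.addRight b)) _ _ fun x => ?_
      simp only [Equiv.trans_apply, Equiv.mulLeft₀_apply, Equiv.coe_addRight]
      congr 1
      ring
  simp only [permRep, Matrix.of_apply]
  rw [Finset.sum_comm, Finset.sum_congr rfl fun a' _ => h a', Finset.sum_add_distrib]
  simp only [Finset.sum_ite_eq', mem_univ, if_true]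
  ring

theorem eq_zero_of_dilationPart_of_augRep [IsDomain R] [CharZero R] {c : (ZMod p)ˣ → ZMod p → R}
    (h₁ : dilationPart c = 0) (h₂ : augRep c = 0) : c = 0 := by
  have h0 : ∀ y x, permRep c y x = permRep c y 0 := by
    have hu : ∀ y x : (ZMod p)ˣ, permRep c y x = permRep c y 0 := fun y x =>
      sub_eq_zero.mp (congrFun (congrFun h₂ y) x)
    intro y x
    rcases eq_or_ne x 0 with rfl | hx
    · rfl
    lift x to (ZMod p)ˣ using hx.isUnit
    rcases eq_or_ne y 0 with rfl | hy
    · have := sum_augRep c x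
      simp only [h₂, Matrix.zero_apply, Finset.sum_const_zero] at this
      exact (sub_eq_zero.mp this.symm).symm
    · lift y to (ZMod p)ˣ using hy.isUnit
      exact hu y x
  ext a b
  have h := sum_permRep_line c a b
  have h' : ∑ x, permRep c (a * x + b) x = 0 := by
    calc _ = ∑ x, permRep c (a * x + b) 0 := Finset.sum_congr rfl fun x _ => h0 _ _
      _ = ∑ y, permRep c y 0 :=
        Fintype.sum_equiv ((Equiv.mulLeft₀ _ a.ne_zero).trans (Equiv.addRight b)) _ _ fun x => rfl
      _ = 0 := by simp [sum_permRep, h₁]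
  rw [h', h₁] at h
  have hp : (p : R) ≠ 0 := Nat.cast_ne_zero.mpr (Fact.out : p.Prime).ne_zero
  simpa [hp] using h

/-- The decomposition of the regular representation of `GA p`. -/
def regularDecomposition (p : ℕ) [Fact p.Prime] (R : Type*) [CommRing R] :
    ((ZMod p)ˣ × ZMod p → R) →ₗ[R] ((ZMod p)ˣ → R) × ((ZMod p)ˣ → (ZMod p)ˣ → R) where
  toFun v := (dilationPart fun a b => v (a, b), fun x y => augRep (fun a b => v (a, b)) y x)
  map_add' v w := by
    ext <;> simp only [dilationPart, augRep, permRep, Pi.add_apply, Prod.fst_add, Prod.snd_add,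
      Matrix.of_apply, Finset.sum_add_distrib]
    ring
  map_smul' r v := by
    ext <;> simp [dilationPart, augRep, permRep, Finset.mul_sum, mul_sub]

theorem regularDecomposition_injective [IsDomain R] [CharZero R] :
    Function.Injective (regularDecomposition p R) := by
  rw [← LinearMap.ker_eq_bot, LinearMap.ker_eq_bot']
  intro v hv
  have h := eq_zero_of_dilationPart_of_augRep (c := fun a b => v (a, b)) (congrArg Prod.fst hv)
    (by ext y x; exact congrFun (congrFun (congrArg Prod.snd hv) x) y)
  ext ⟨a, b⟩
  exact congrFun (congrFun h a) b

/-- `regularDecomposition` intertwines convolution with the block action, one copy of `augRep c` for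
each column. It is injective, and `(p - 1) + (p - 1) ^ 2 = p * (p - 1)` makes it an isomorphism. -/
theorem det_convMatrix_of_field {K : Type*} [Field K] [CharZero K] (c : (ZMod p)ˣ → ZMod p → K) :
    (convMatrix c).det = (dilationMatrix (dilationPart c)).det * (augRep c).det ^ (p - 1) := by
  have hcard : Fintype.card (ZMod p)ˣ = p - 1 := ZMod.card_units p
  have hp : 1 ≤ p := (Fact.out : p.Prime).one_le
  have hdim : Module.finrank K ((ZMod p)ˣ × ZMod p → K) =
      Module.finrank K (((ZMod p)ˣ → K) × ((ZMod p)ˣ → (ZMod p)ˣ → K)) := by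
    rw [Module.finrank_prod, Module.finrank_pi_fintype, Module.finrank_pi_fintype,
      Module.finrank_pi_fintype, Module.finrank_pi_fintype]
    simp only [Module.finrank_self, Fintype.card_prod, hcard, ZMod.card,
      Finset.sum_const, Finset.card_univ, smul_eq_mul]
    obtain ⟨q, rfl⟩ := Nat.exists_eq_add_of_le' hp
    simp only [Nat.add_sub_cancel]
    ring
  let e := (regularDecomposition p K).linearEquivOfInjective regularDecomposition_injective hdim
  have he : ∀ v, e v = regularDecomposition p K v := fun v =>
    LinearMap.linearEquivOfInjective_apply ..
  have hconj : (e : _ →ₗ[K] _) ∘ₗ Matrix.toLin' (convMatrix c) ∘ₗ (e.symm : _ →ₗ[K] _) =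
      (Matrix.toLin' (dilationMatrix (dilationPart c))).prodMap
        (LinearMap.pi fun x : (ZMod p)ˣ => Matrix.toLin' (augRep c) ∘ₗ LinearMap.proj x) := by
    rw [← LinearMap.comp_assoc, LinearEquiv.comp_toLinearMap_symm_eq]
    refine LinearMap.ext fun v => ?_
    simp only [LinearMap.comp_apply, LinearEquiv.coe_coe, he, Matrix.toLin'_apply,
      convMatrix_mulVec, LinearMap.prodMap_apply]
    refine Prod.ext (dilationPart_conv _ _) ?_
    ext x y
    exact congrFun (congrFun (augRep_conv c fun a b => v (a, b)) y) x
  rw [← LinearMap.det_toLin', ← LinearMap.det_conj _ e, hconj, LinearMap.det_prodMap,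
    LinearMap.det_pi, LinearMap.det_toLin', Finset.prod_const, Finset.card_univ, hcard,
    LinearMap.det_toLin']

theorem det_convMatrix (c : (ZMod p)ˣ → ZMod p → ℤ) :
    (convMatrix c).det = (dilationMatrix (dilationPart c)).det * (augRep c).det ^ (p - 1) := by
  have h := det_convMatrix_of_field (K := ℚ) fun (a : (ZMod p)ˣ) b => (c a b : ℚ)
  have h₁ : convMatrix (fun (a : (ZMod p)ˣ) b => (c a b : ℚ)) =
      (convMatrix c).map (Int.castRingHom ℚ) := by ext; simp [convMatrix]
  have h₂ : dilationMatrix (dilationPart fun (a : (ZMod p)ˣ) b => (c a b : ℚ)) =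
      (dilationMatrix (dilationPart c)).map (Int.castRingHom ℚ) := by
    ext; simp [dilationMatrix, dilationPart]
  have h₃ : augRep (fun (a : (ZMod p)ˣ) b => (c a b : ℚ)) =
      (augRep c).map (Int.castRingHom ℚ) := by ext; simp [augRep, permRep]
  rw [h₁, h₂, h₃, ← RingHom.mapMatrix_apply, ← RingHom.mapMatrix_apply, ← RingHom.mapMatrix_apply,
    ← RingHom.map_det, ← RingHom.map_det, ← RingHom.map_det] at h
  simp only [eq_intCast] at h
  exact_mod_cast h

end Representations

theorem groupDet_eq_det_convMatrix (α : MonoidAlgebra ℤ (GA p)) :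
    groupDet α = (convMatrix fun a b => α.coeff (GA.coords (a, b))).det := by
  rw [groupDet, ← Matrix.det_submatrix_equiv_self GA.coords]
  congr 1
  ext g h
  simp [convMatrix, GA.coords_mul_inv]

/-- The integer group determinants of `GA p` in terms of the two building blocks of its regular
representation. -/
theorem mem_integerGroupDets_GA_iff (D : ℤ) :
    D ∈ integerGroupDets (GA p) ↔ ∃ c : (ZMod p)ˣ → ZMod p → ℤ,
      D = (dilationMatrix (dilationPart c)).det * (augRep c).det ^ (p - 1) := by
  constructor
  · rintro ⟨α, rfl⟩
    exact ⟨_, (groupDet_eq_det_convMatrix α).trans (det_convMatrix _)⟩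
  · rintro ⟨c, rfl⟩
    refine ⟨.ofCoeff (Finsupp.equivFunOnFinite.symm fun g =>
      c (GA.coords.symm g).1 (GA.coords.symm g).2), ?_⟩
    rw [← det_convMatrix]
    refine (groupDet_eq_det_convMatrix _).trans ?_
    simp

/-! ### Congruence of the two determinants modulo `p` -/

section ModP

/-- The matrix of the monomials `x ^ (i + 1)` on the nonzero residues. -/
def monomialMatrix (e : Fin (p - 1) ≃ (ZMod p)ˣ) : Matrix (Fin (p - 1)) (Fin (p - 1)) (ZMod p) :=
  .of fun i x => (e x : ZMod p) ^ (i.val + 1)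

theorem det_monomialMatrix_ne_zero (e : Fin (p - 1) ≃ (ZMod p)ˣ) :
    (monomialMatrix e).det ≠ 0 := by
  have h : monomialMatrix e = (Matrix.vandermonde fun x => (e x : ZMod p)).transpose *
      Matrix.diagonal fun x => (e x : ZMod p) := by
    ext i x
    simp [monomialMatrix, Matrix.mul_diagonal, Matrix.vandermonde_apply, pow_succ]
  rw [h, Matrix.det_mul, Matrix.det_transpose, Matrix.det_diagonal]
  refine mul_ne_zero (Matrix.det_vandermonde_ne_zero_iff.mpr ?_)
    (Finset.prod_ne_zero_iff.mpr fun x _ => (e x).ne_zero)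
  exact Units.val_injective.comp e.injective

/-- Monomials are multiplicative characters of `(ZMod p)ˣ`, hence left eigenvectors. -/
theorem monomialMatrix_mul_dilationMatrix (e : Fin (p - 1) ≃ (ZMod p)ˣ)
    (f : (ZMod p)ˣ → ZMod p) :
    monomialMatrix e * (dilationMatrix f).submatrix e e =
      Matrix.diagonal (fun i => ∑ a, f a * (a : ZMod p) ^ (i.val + 1)) * monomialMatrix e := by
  ext i x
  rw [Matrix.diagonal_mul, Matrix.mul_apply]
  simp only [monomialMatrix, Matrix.of_apply, dilationMatrix, Matrix.submatrix_apply]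
  rw [Finset.sum_mul]
  refine Fintype.sum_equiv (e.trans (Equiv.divRight (e x))) _ _ fun y => ?_
  simp only [Equiv.trans_apply, Equiv.divRight_apply]
  have : (e y : ZMod p) = ↑(e y / e x) * ↑(e x) := by rw [← Units.val_mul, div_mul_cancel]
  rw [this, mul_pow]
  ring

/-- The matrix of the action on polynomial functions without constant term. -/
def polynomialAction (c : (ZMod p)ˣ → ZMod p → ZMod p) :
    Matrix (Fin (p - 1)) (Fin (p - 1)) (ZMod p) :=
  .of fun i j => ∑ a, ∑ b, c a b *
    ((a : ZMod p) ^ (j.val + 1) * b ^ (i.val - j.val) * ((i.val + 1).choose (j.val + 1)))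

theorem affine_pow_sub_pow (a : ZMod p) (b x : ZMod p) (i : Fin (p - 1)) :
    (a * x + b) ^ (i.val + 1) - b ^ (i.val + 1) =
      ∑ j : Fin (p - 1), a ^ (j.val + 1) * b ^ (i.val - j.val) *
        ((i.val + 1).choose (j.val + 1)) * x ^ (j.val + 1) := by
  rw [add_pow, Finset.sum_range_succ', Fin.sum_univ_eq_sum_range
    (fun j => a ^ (j + 1) * b ^ (i.val - j) * ((i.val + 1).choose (j + 1)) * x ^ (j + 1))]
  simp only [pow_zero, Nat.sub_zero, Nat.choose_zero_right, Nat.cast_one, mul_one, one_mul,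
    add_sub_cancel_right]
  have hsub : Finset.range (i.val + 1) ⊆ Finset.range (p - 1) := by
    simp
  rw [← Finset.sum_subset hsub]
  · refine Finset.sum_congr rfl fun j _ => ?_
    rw [Nat.add_sub_add_right, mul_pow]
    ring
  · intro j _ hj
    rw [Nat.choose_eq_zero_of_lt (by simpa using hj)]
    simp

/-- Pairing a monomial with `e_x - e_0` kills constants, so the dual action is substitution of `a *
x + b` followed by dropping the constant term. -/
theorem monomialMatrix_mul_augRep (e : Fin (p - 1) ≃ (ZMod p)ˣ)
    (c : (ZMod p)ˣ → ZMod p → ZMod p) :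
    monomialMatrix e * (augRep c).submatrix e e = polynomialAction c * monomialMatrix e := by
  ext i x
  have hS : ∀ z : ZMod p, ∑ y, y ^ (i.val + 1) * permRep c y z =
      ∑ a : (ZMod p)ˣ, ∑ b, c a b * (a * z + b) ^ (i.val + 1) := by
    intro z
    simp only [permRep, Matrix.of_apply, Finset.mul_sum]
    rw [Finset.sum_comm]
    refine Finset.sum_congr rfl fun a _ => Fintype.sum_equiv (Equiv.subRight (a * z)) _ _ ?_
    intro y
    simp only [Equiv.subRight_apply, add_sub_cancel]
    ring
  have h0 := sum_units_add_zero fun y =>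
    y ^ (i.val + 1) * (permRep c y (e x) - permRep c y 0)
  simp only [ne_eq, Nat.add_eq_zero_iff, one_ne_zero, and_false, not_false_eq_true, zero_pow,
    zero_mul, add_zero] at h0
  have h1 : (monomialMatrix e * (augRep c).submatrix e e) i x =
      ∑ y : (ZMod p)ˣ, (y : ZMod p) ^ (i.val + 1) * (permRep c y (e x) - permRep c y 0) := by
    simp only [Matrix.mul_apply, monomialMatrix, Matrix.of_apply, augRep, Matrix.submatrix_apply]
    exact Fintype.sum_equiv e _ _ fun _ => rfl
  rw [h1, h0]
  simp only [mul_sub, Finset.sum_sub_distrib, hS, Matrix.mul_apply, polynomialAction,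
    monomialMatrix, Matrix.of_apply, Finset.sum_mul]
  rw [← Finset.sum_sub_distrib, Finset.sum_comm]
  refine Finset.sum_congr rfl fun a _ => ?_
  rw [← Finset.sum_sub_distrib, Finset.sum_comm]
  refine Finset.sum_congr rfl fun b _ => ?_
  have := affine_pow_sub_pow a b (e x) i
  rw [mul_zero, zero_add, ← mul_sub, this, Finset.mul_sum]
  exact Finset.sum_congr rfl fun j _ => by ring

/-- Affine substitution does not raise the degree and scales the leading term by a power of `a`;
translations disappear from the diagonal. -/
theorem det_polynomialAction (c : (ZMod p)ˣ → ZMod p → ZMod p) :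
    (polynomialAction c).det =
      ∏ i : Fin (p - 1), ∑ a, dilationPart c a * (a : ZMod p) ^ (i.val + 1) := by
  rw [Matrix.det_of_isLowerTriangular]
  · refine Finset.prod_congr rfl fun i _ => Finset.sum_congr rfl fun a _ => ?_
    simp [dilationPart, Finset.sum_mul]
  · intro i j hij
    have hij' : i.val < j.val := hij
    simp [polynomialAction, Nat.choose_eq_zero_of_lt (Nat.succ_lt_succ hij')]

theorem det_augRep_eq_det_dilationMatrix (c : (ZMod p)ˣ → ZMod p → ZMod p) :
    (augRep c).det = (dilationMatrix (dilationPart c)).det := by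
  have e : Fin (p - 1) ≃ (ZMod p)ˣ := (Fintype.equivFinOfCardEq (ZMod.card_units p)).symm
  have hV := det_monomialMatrix_ne_zero e
  have h1 := congrArg Matrix.det (monomialMatrix_mul_augRep e c)
  have h2 := congrArg Matrix.det (monomialMatrix_mul_dilationMatrix e (dilationPart c))
  rw [Matrix.det_mul, Matrix.det_mul, Matrix.det_submatrix_equiv_self] at h1 h2
  rw [det_polynomialAction, mul_comm] at h1
  rw [Matrix.det_diagonal, mul_comm] at h2
  exact (mul_right_cancel₀ hV h1).trans (mul_right_cancel₀ hV h2).symm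

theorem det_augRep_modEq (c : (ZMod p)ˣ → ZMod p → ℤ) :
    (dilationMatrix (dilationPart c)).det ≡ (augRep c).det [ZMOD p] := by
  rw [← ZMod.intCast_eq_intCast_iff]
  have h := det_augRep_eq_det_dilationMatrix fun (a : (ZMod p)ˣ) b => (c a b : ZMod p)
  have h₂ : dilationMatrix (dilationPart fun (a : (ZMod p)ˣ) b => (c a b : ZMod p)) =
      (dilationMatrix (dilationPart c)).map (Int.castRingHom (ZMod p)) := by
    ext; simp [dilationMatrix, dilationPart]
  have h₃ : augRep (fun (a : (ZMod p)ˣ) b => (c a b : ZMod p)) =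
      (augRep c).map (Int.castRingHom (ZMod p)) := by ext; simp [augRep, permRep]
  rw [h₂, h₃, ← RingHom.mapMatrix_apply, ← RingHom.mapMatrix_apply,
    ← RingHom.map_det, ← RingHom.map_det] at h
  simpa using h.symm

end ModP

/-! ### Circulant determinants of order six -/

section Seven

theorem fact_prime_seven : Fact (Nat.Prime 7) := ⟨by norm_num⟩

attribute [local instance] fact_prime_seven

/-- The residue `3` is a primitive root modulo `7`. -/
def primitiveRoot : (ZMod 7)ˣ := ⟨3, 5, rfl, rfl⟩

/-- The discrete exponential modulo `7`. -/
noncomputable def expEquiv : Fin 6 ≃ (ZMod 7)ˣ :=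
  Equiv.ofBijective (fun i => primitiveRoot ^ i.val) (by decide)

theorem expEquiv_apply (i : Fin 6) : expEquiv i = primitiveRoot ^ i.val := rfl

theorem expEquiv_div (i j : Fin 6) : expEquiv i / expEquiv j = expEquiv (i - j) := by
  simp only [expEquiv_apply]
  revert i j
  decide

theorem det_dilationMatrix_eq_det_circulant (f : (ZMod 7)ˣ → ℤ) :
    (dilationMatrix f).det = (Matrix.circulant fun i => f (expEquiv i)).det := by
  rw [← Matrix.det_submatrix_equiv_self expEquiv]
  congr 1
  ext i j
  simp [dilationMatrix, expEquiv_div, Matrix.circulant_apply]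

/-- The change of basis to `ℤ × ℤ × ℤ[ω] × ℤ[-ω]`, for `ω` a primitive cube root of unity. -/
def cyclotomicBasis : Matrix (Fin 6) (Fin 6) ℤ :=
  !![1, 1, 1, 1, 1, 1; 1, -1, 1, -1, 1, -1; 1, 0, -1, 1, 0, -1; 0, 1, -1, 0, 1, -1;
    1, 0, -1, -1, 0, 1; 0, 1, 1, 0, -1, -1]

theorem det_cyclotomicBasis_ne_zero : cyclotomicBasis.det ≠ 0 := by
  simp [cyclotomicBasis, Matrix.det_succ_row_zero, Fin.sum_univ_succ, Fin.succAbove]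

/-- The action of an element of the group ring of the cyclic group of order six in the basis
`cyclotomicBasis`. -/
def cyclotomicBlocks (s t u v x y : ℤ) : Matrix (Fin 6) (Fin 6) ℤ :=
  !![s, 0, 0, 0, 0, 0; 0, t, 0, 0, 0, 0; 0, 0, u, -v, 0, 0; 0, 0, v, u - v, 0, 0;
    0, 0, 0, 0, x, -y; 0, 0, 0, 0, y, x + y]

theorem det_cyclotomicBlocks (s t u v x y : ℤ) : (cyclotomicBlocks s t u v x y).det =
    s * t * (u ^ 2 - u * v + v ^ 2) * (x ^ 2 + x * y + y ^ 2) := by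
  simp [cyclotomicBlocks, Matrix.det_succ_row_zero, Fin.sum_univ_succ, Fin.succAbove]
  ring

/-- The factors are the values of `∑ F i * X ^ i` at `1` and `-1`, and the norms of its values at
primitive cube and sixth roots of unity. -/
theorem det_circulant_six (F : Fin 6 → ℤ) : (Matrix.circulant F).det =
    (F 0 + F 1 + F 2 + F 3 + F 4 + F 5) * (F 0 - F 1 + F 2 - F 3 + F 4 - F 5) *
    ((F 0 - F 2 + F 3 - F 5) ^ 2 - (F 0 - F 2 + F 3 - F 5) * (F 1 - F 2 + F 4 - F 5) +
      (F 1 - F 2 + F 4 - F 5) ^ 2) *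
    ((F 0 - F 2 - F 3 + F 5) ^ 2 + (F 0 - F 2 - F 3 + F 5) * (F 1 + F 2 - F 4 - F 5) +
      (F 1 + F 2 - F 4 - F 5) ^ 2) := by
  have h : cyclotomicBasis * Matrix.circulant F =
      cyclotomicBlocks (F 0 + F 1 + F 2 + F 3 + F 4 + F 5) (F 0 - F 1 + F 2 - F 3 + F 4 - F 5)
        (F 0 - F 2 + F 3 - F 5) (F 1 - F 2 + F 4 - F 5) (F 0 - F 2 - F 3 + F 5)
        (F 1 + F 2 - F 4 - F 5) * cyclotomicBasis := by
    have e1 : (-1 : Fin 6) = 5 := rfl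
    have e2 : (-2 : Fin 6) = 4 := rfl
    have e3 : (-3 : Fin 6) = 3 := rfl
    have e4 : (-4 : Fin 6) = 2 := rfl
    have e5 : (-5 : Fin 6) = 1 := rfl
    ext i j
    fin_cases i <;> fin_cases j <;>
      simp [cyclotomicBasis, cyclotomicBlocks, Matrix.mul_apply, Fin.sum_univ_succ,
        Matrix.circulant_apply, e1, e2, e3, e4, e5] <;> ring
  have h' := congrArg Matrix.det h
  rw [Matrix.det_mul, Matrix.det_mul, mul_comm, det_cyclotomicBlocks] at h'
  exact mul_right_cancel₀ det_cyclotomicBasis_ne_zero h'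

end Seven

/-! ### Adding a constant to one row -/

section RowUpdate

variable {R : Type*} [CommRing R] {n : ℕ}

/-- The differences of the columns of `A` with its column `0`, without row `i`. -/
def columnDifferences (A : Matrix (Fin (n + 1)) (Fin (n + 1)) R) (i : Fin (n + 1)) :
    Matrix (Fin n) (Fin n) R :=
  .of fun r s => A (i.succAbove r) s.succ - A (i.succAbove r) 0

/-- Subtracting column `0` from the others turns row `i` into `(1, 0, …, 0)`; then expand along it.
-/
theorem det_updateRow_one (A : Matrix (Fin (n + 1)) (Fin (n + 1)) R) (i : Fin (n + 1)) :
    (A.updateRow i 1).det = (-1) ^ i.val * (columnDifferences A i).det := by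
  let B : Matrix (Fin (n + 1)) (Fin (n + 1)) R :=
    .of fun r s => A.updateRow i 1 r s - if s = 0 then 0 else A.updateRow i 1 r 0
  have hB : (A.updateRow i 1).det = B.det := by
    rw [← Matrix.det_transpose, ← Matrix.det_transpose B]
    refine Matrix.det_eq_of_forall_row_eq_smul_add_const (fun s => if s = 0 then 0 else 1) 0
      (by simp) fun s r => ?_
    by_cases hs : s = 0 <;> simp [B, hs]
  rw [hB, Matrix.det_succ_row B i, Finset.sum_eq_single 0]
  · have : B.submatrix i.succAbove (0 : Fin (n + 1)).succAbove = columnDifferences A i := by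
      ext r s
      simp [B, columnDifferences]
    rw [this]
    simp [B]
  · intro s _ hs
    simp [B, hs]
  · simp

theorem det_add_const_row (A : Matrix (Fin (n + 1)) (Fin (n + 1)) R) (i : Fin (n + 1)) (t : R) :
    (Matrix.of fun r s => A r s + if r = i then t else 0).det =
      A.det + t * ((-1) ^ i.val * (columnDifferences A i).det) := by
  have : (Matrix.of fun r s => A r s + if r = i then t else 0) =
      A.updateRow i (A i + t • 1) := by
    ext r s
    by_cases hr : r = i
    · subst hr
      simp
    · simp [hr]
  rw [this, Matrix.det_updateRow_add, Matrix.det_updateRow_smul, Matrix.updateRow_eq_self,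
    det_updateRow_one]

end RowUpdate

/-! ### Realizing every `N` in the residue class -/

section Realization

variable {R : Type*} [CommRing R]

theorem dilationPart_add_translation (γ : (ZMod p)ˣ → ZMod p → R) (δ : ZMod p → R) (a : (ZMod p)ˣ) :
    dilationPart (fun a b => γ a b + δ b) a = dilationPart γ a + ∑ b, δ b := by
  simp [dilationPart, Finset.sum_add_distrib]

/-- For `x ≠ 0` the points `y - a * x` run over everything except `y`, whereas for `x = 0` all `p -
1` of them equal `y`. Each row is thus shifted by a constant. -/
theorem augRep_add_translation (γ : (ZMod p)ˣ → ZMod p → R) (δ : ZMod p → R) (y x : (ZMod p)ˣ) :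
    augRep (fun a b => γ a b + δ b) y x = augRep γ y x + (∑ b, δ b - p * δ y) := by
  have h : ∑ a : (ZMod p)ˣ, δ ((y : ZMod p) - ↑a * ↑x) = ∑ b, δ b - δ y := by
    have h0 := sum_units_add_zero fun z : ZMod p => δ (y - z * x)
    simp only [zero_mul, sub_zero] at h0
    rw [eq_sub_iff_add_eq, h0]
    exact Fintype.sum_equiv ((Equiv.mulRight₀ _ x.ne_zero).trans (Equiv.subLeft (y : ZMod p))) _ _
      fun z => rfl
  have hc : (Fintype.card (ZMod p)ˣ : R) = p - 1 := by
    rw [ZMod.card_units, Nat.cast_sub (Fact.out : p.Prime).one_le, Nat.cast_one]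
  simp only [augRep, permRep, Matrix.of_apply, Finset.sum_add_distrib, h, mul_zero, sub_zero,
    Finset.sum_const, Finset.card_univ, nsmul_eq_mul, hc]
  ring

/-- If a suitable minor of `augRep γ` is a unit, then adding to `γ` combinations of translates of
the sum of all dilations realizes every determinant allowed by `det_augRep_modEq`. -/
theorem exists_det_augRep_eq {n : ℕ} (e : Fin (n + 1) ≃ (ZMod p)ˣ) (γ : (ZMod p)ˣ → ZMod p → ℤ)
    (i : Fin (n + 1))
    (hγ : IsUnit (columnDifferences ((augRep γ).submatrix e e) i).det) (k N : ℤ)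
    (hN : (dilationMatrix fun a => dilationPart γ a + k).det ≡ N [ZMOD p]) :
    ∃ c : (ZMod p)ˣ → ZMod p → ℤ, (dilationPart c = fun a => dilationPart γ a + k) ∧
      (augRep c).det = N := by
  -- The total mass is `k` for every `d`. Moving `d` from `e i` to `0` adds `p * d` to row `i`
  -- alone, since `augRep` has no row `0`.
  let δ (d : ℤ) (b : ZMod p) : ℤ := (if b = 0 then k + d else 0) + if b = e i then -d else 0
  have hδ : ∀ d, ∑ b, δ d b = k := by
    intro d
    simp [δ, Finset.sum_add_distrib]
  let c (d : ℤ) (a : (ZMod p)ˣ) (b : ZMod p) : ℤ := γ a b + δ d b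
  have hf : ∀ d, dilationPart (c d) = fun a => dilationPart γ a + k := fun d => by
    ext a
    rw [← hδ d]
    exact dilationPart_add_translation γ (δ d) a
  have haug : ∀ d y x, augRep (c d) y x = augRep γ y x + (k - p * δ d y) := fun d y x => by
    have := augRep_add_translation γ (δ d) y x
    rwa [hδ] at this
  have hdet : ∀ d, (augRep (c d)).det = (augRep (c 0)).det +
      p * d * ((-1) ^ i.val * (columnDifferences ((augRep γ).submatrix e e) i).det) := by
    intro d
    have h := det_add_const_row ((augRep (c 0)).submatrix e e) i (p * d)
    have h1 : (Matrix.of fun r s => (augRep (c 0)).submatrix e e r s + if r = i then p * d else 0) =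
        (augRep (c d)).submatrix e e := by
      ext r s
      simp only [Matrix.of_apply, Matrix.submatrix_apply, haug, δ, Units.ne_zero, if_false,
        Units.val_inj, e.injective.eq_iff]
      split_ifs <;> ring
    have h2 : columnDifferences ((augRep (c 0)).submatrix e e) i =
        columnDifferences ((augRep γ).submatrix e e) i := by
      ext r s
      simp only [columnDifferences, Matrix.of_apply, Matrix.submatrix_apply, haug]
      ring
    rwa [h1, h2, Matrix.det_submatrix_equiv_self, Matrix.det_submatrix_equiv_self] at h
  set u := (-1) ^ i.val * (columnDifferences ((augRep γ).submatrix e e) i).det with hu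
  have hu1 : u * u = 1 := by
    have : IsUnit u := (isUnit_one.neg.pow _).mul hγ
    rcases Int.isUnit_iff.mp this with h | h <;> rw [h] <;> rfl
  have h0 := det_augRep_modEq (c 0)
  rw [hf] at h0
  obtain ⟨q, hq⟩ := (h0.symm.trans hN).dvd
  -- As `u * u = 1`, this choice changes the determinant by exactly `p * q`.
  refine ⟨c (q * u), hf _, ?_⟩
  rw [hdet]
  linear_combination (p : ℤ) * q * hu1 - hq

end Realization

/-! ### Admissible pairs for `p = 7` -/

section Main

attribute [local instance] fact_prime_seven

theorem four_dvd_mul_of_even_sub {a b : ℤ} (hab : 2 ∣ a - b) (h : 2 ∣ a * b) : 4 ∣ a * b := by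
  rcases Int.prime_two.dvd_or_dvd h with h | h
  · exact mul_dvd_mul (a := (2 : ℤ)) h ((dvd_sub_right h).mp hab)
  · exact mul_dvd_mul (a := (2 : ℤ)) ((dvd_sub_left h).mp hab) h

theorem nine_dvd_mul_of_dvd_sq_sub {a b : ℤ} (hab : 3 ∣ a ^ 2 - b) (h : 3 ∣ a * b) :
    9 ∣ a * b := by
  have hp : Prime (3 : ℤ) := Int.prime_three
  rcases hp.dvd_or_dvd h with h | h
  · exact mul_dvd_mul (a := (3 : ℤ)) h ((dvd_sub_right (dvd_pow h two_ne_zero)).mp hab)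
  · exact mul_dvd_mul (a := (3 : ℤ)) (hp.dvd_of_dvd_pow ((dvd_sub_left h).mp hab)) h

/-- Modulo 2 the values at `1` and `-1` agree, and so do the two norms, since `ω ≡ -ω`. An even
factor therefore has an even partner. -/
theorem four_dvd_det_circulant_six (F : Fin 6 → ℤ) (h : 2 ∣ (Matrix.circulant F).det) :
    4 ∣ (Matrix.circulant F).det := by
  rw [det_circulant_six, mul_assoc] at h ⊢
  rcases Int.prime_two.dvd_or_dvd h with h | h
  · refine (four_dvd_mul_of_even_sub ⟨F 1 + F 3 + F 5, by ring⟩ h).mul_right _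
  · refine (four_dvd_mul_of_even_sub ?_ h).mul_left _
    generalize hu : F 0 - F 2 + F 3 - F 5 = u
    generalize hv : F 1 - F 2 + F 4 - F 5 = v
    have hx : F 0 - F 2 - F 3 + F 5 = u + 2 * (F 5 - F 3) := by rw [← hu]; ring
    have hy : F 1 + F 2 - F 4 - F 5 = v + 2 * (F 2 - F 4) := by rw [← hv]; ring
    rw [hx, hy]
    generalize F 5 - F 3 = α
    generalize F 2 - F 4 = β
    exact ⟨-u * v - 2 * u * α - 2 * α ^ 2 - u * β - α * v - 2 * α * β - 2 * v * β - 2 * β ^ 2,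
      by ring⟩

/-- Since `ω ≡ 1` modulo the prime above 3, the norm at `ω` is congruent modulo 3 to the square of
the value at `1`; likewise for `-ω` and `-1`. -/
theorem nine_dvd_det_circulant_six (F : Fin 6 → ℤ) (h : 3 ∣ (Matrix.circulant F).det) :
    9 ∣ (Matrix.circulant F).det := by
  have key : ∀ s t a b : ℤ, s * t * a * b = (s * a) * (t * b) := fun s t a b => by ring
  rw [det_circulant_six, key] at h ⊢
  rcases Int.prime_three.dvd_or_dvd h with h | h
  · refine (nine_dvd_mul_of_dvd_sq_sub ?_ h).mul_right _
    generalize hu : F 0 - F 2 + F 3 - F 5 = u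
    generalize hv : F 1 - F 2 + F 4 - F 5 = v
    have hs : F 0 + F 1 + F 2 + F 3 + F 4 + F 5 = u + v + 3 * (F 2 + F 5) := by
      rw [← hu, ← hv]; ring
    rw [hs]
    exact ⟨u * v + 2 * (u + v) * (F 2 + F 5) + 3 * (F 2 + F 5) ^ 2, by ring⟩
  · refine (nine_dvd_mul_of_dvd_sq_sub ?_ h).mul_left _
    generalize hx : F 0 - F 2 - F 3 + F 5 = x
    generalize hy : F 1 + F 2 - F 4 - F 5 = y
    have ht : F 0 - F 1 + F 2 - F 3 + F 4 - F 5 = x - y + 3 * (F 2 - F 5) := by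
      rw [← hx, ← hy]; ring
    rw [ht]
    exact ⟨-x * y + 2 * (x - y) * (F 2 - F 5) + 3 * (F 2 - F 5) ^ 2, by ring⟩

/-- The pairs `(m, N)` of values of the two determinants in `det_convMatrix`. -/
def IsDetPair (m N : ℤ) : Prop :=
  ∃ c : (ZMod 7)ˣ → ZMod 7 → ℤ, (dilationMatrix (dilationPart c)).det = m ∧ (augRep c).det = N

theorem isDetPair_of_isUnit (γ : (ZMod 7)ˣ → ZMod 7 → ℤ) (F : Fin 6 → ℤ) (i : Fin 6)
    (M : Matrix (Fin 5) (Fin 5) ℤ)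
    (hF : ∀ j, dilationPart γ (expEquiv j) = F j)
    (hM : columnDifferences ((augRep γ).submatrix expEquiv expEquiv) i = M)
    (hu : IsUnit M.det) (k N : ℤ)
    (hN : (Matrix.circulant fun j => F j + k).det ≡ N [ZMOD 7]) :
    IsDetPair (Matrix.circulant fun j => F j + k).det N := by
  have h : (dilationMatrix fun a => dilationPart γ a + k).det =
      (Matrix.circulant fun j => F j + k).det := by
    rw [det_dilationMatrix_eq_det_circulant]
    simp only [hF]
  subst hM
  obtain ⟨c, hc, hN⟩ := exists_det_augRep_eq expEquiv γ i hu k N (by rw [h]; exact hN)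
  exact ⟨c, by rw [hc, h], hN⟩

/-- The sum of the group elements `x ↦ 3 ^ i * x + b` for `(i, b)` in a list. -/
def elementSum (l : List (ℕ × ZMod 7)) (a : (ZMod 7)ˣ) (b : ZMod 7) : ℤ :=
  l.countP fun t => primitiveRoot ^ t.1 = a ∧ t.2 = b

/-- Here and in the next five lemmas, adding `k` to all coefficients changes only the factor at the
trivial character, by `6 * k`, so `m` is linear in `k`. -/
theorem isDetPair_one_add (k N : ℤ) (hN : 1 + 6 * k ≡ N [ZMOD 7]) :
    IsDetPair (1 + 6 * k) N := by
  have hm : (Matrix.circulant fun j => (![1, 0, 0, 0, 0, 0] : Fin 6 → ℤ) j + k).det =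
      1 + 6 * k := by
    rw [det_circulant_six]
    simp
    ring
  rw [← hm] at hN ⊢
  exact isDetPair_of_isUnit (elementSum [(0, 0)]) _ 0
    !![1, 0, 0, 0, 0; 0, 1, 0, 0, 0; 0, 0, 1, 0, 0; 0, 0, 0, 1, 0; 0, 0, 0, 0, 1]
    (by decide +kernel) (by decide +kernel) (by decide +kernel) k N hN

theorem isDetPair_neg_one_sub (k N : ℤ) (hN : -1 - 6 * k ≡ N [ZMOD 7]) :
    IsDetPair (-1 - 6 * k) N := by
  have hm : (Matrix.circulant fun j => (![0, 1, 0, 0, 0, 0] : Fin 6 → ℤ) j + k).det =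
      -1 - 6 * k := by
    rw [det_circulant_six]
    simp
    ring
  rw [← hm] at hN ⊢
  exact isDetPair_of_isUnit (elementSum [(1, 0)]) _ 0
    !![-1, -1, -1, -1, -1; 1, 0, 0, 0, 0; 0, 1, 0, 0, 0; 0, 0, 1, 0, 0; 0, 0, 0, 1, 0]
    (by decide +kernel) (by decide +kernel) (by decide +kernel) k N hN

theorem isDetPair_neg_eight_sub (k N : ℤ) (hN : -8 - 12 * k ≡ N [ZMOD 7]) :
    IsDetPair (-8 - 12 * k) N := by
  have hm : (Matrix.circulant fun j => (![0, 1, 1, 1, 0, 1] : Fin 6 → ℤ) j + k).det =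
      -8 - 12 * k := by
    rw [det_circulant_six]
    simp
    ring
  rw [← hm] at hN ⊢
  -- The exponents are dictated by the circulant; the translations do not affect `m` and serve to
  -- make the minor a unit.
  exact isDetPair_of_isUnit (elementSum [(1, 3), (5, 6), (2, 4), (3, 4)]) _ 0
    !![0, -1, -1, -1, 0; 0, 3, 1, 0, 0; -2, -2, -2, -2, -1; -1, -1, -1, -1, 0; 1, 0, 1, 2, 0]
    (by decide +kernel) (by decide +kernel) (by decide +kernel) k N hN

theorem isDetPair_eight_add (k N : ℤ) (hN : 8 + 12 * k ≡ N [ZMOD 7]) :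
    IsDetPair (8 + 12 * k) N := by
  have hm : (Matrix.circulant fun j => (![1, 0, 1, 1, 1, 0] : Fin 6 → ℤ) j + k).det =
      8 + 12 * k := by
    rw [det_circulant_six]
    simp
    ring
  rw [← hm] at hN ⊢
  exact isDetPair_of_isUnit (elementSum [(2, 3), (0, 6), (3, 4), (4, 4)]) _ 0
    !![-1, -1, -1, 0, 0; 3, 1, 0, 0, 0; 0, 0, 0, 1, 2; 0, 0, 0, 1, 1; -1, 0, 1, -1, -1]
    (by decide +kernel) (by decide +kernel) (by decide +kernel) k N hN

theorem isDetPair_neg_nine_sub (k N : ℤ) (hN : -9 - 18 * k ≡ N [ZMOD 7]) :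
    IsDetPair (-9 - 18 * k) N := by
  have hm : (Matrix.circulant fun j => (![1, 1, 0, 1, 0, 0] : Fin 6 → ℤ) j + k).det =
      -9 - 18 * k := by
    rw [det_circulant_six]
    simp
    ring
  rw [← hm] at hN ⊢
  exact isDetPair_of_isUnit (elementSum [(0, 0), (1, 0), (3, 1)]) _ 3
    !![-1, -1, -1, -1, 0; 0, -1, -1, -1, 0; 1, 1, 1, 0, 0; 0, 0, 1, 2, 0; 1, 0, 0, 1, 1]
    (by decide +kernel) (by decide +kernel) (by decide +kernel) k N hN

theorem isDetPair_thirtysix_mul (k N : ℤ) (hN : 36 * k ≡ N [ZMOD 7]) :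
    IsDetPair (36 * k) N := by
  have hm : (Matrix.circulant fun j => (![1, -1, 0, 0, 0, 0] : Fin 6 → ℤ) j + k).det =
      36 * k := by
    rw [det_circulant_six]
    simp
    ring
  rw [← hm] at hN ⊢
  exact isDetPair_of_isUnit (elementSum [(0, 0)] - elementSum [(1, 1)]) _ 1
    !![-1, -1, -1, -1, -1; 0, 1, 0, 0, -1; 0, 0, 1, -1, 0; 1, 1, 1, 2, 1; 0, 0, -1, 0, 1]
    (by decide +kernel) (by decide +kernel) (by decide +kernel) k N hN

theorem isDetPair_iff (m N : ℤ) :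
    IsDetPair m N ↔ m ≡ N [ZMOD 7] ∧ (Odd m ∨ 4 ∣ m) ∧ (¬ 3 ∣ m ∨ 9 ∣ m) := by
  constructor
  · rintro ⟨c, rfl, rfl⟩
    refine ⟨det_augRep_modEq c, ?_⟩
    rw [det_dilationMatrix_eq_det_circulant]
    have h2 := four_dvd_det_circulant_six fun i => dilationPart c (expEquiv i)
    have h3 := nine_dvd_det_circulant_six fun i => dilationPart c (expEquiv i)
    rw [← even_iff_two_dvd] at h2
    refine ⟨?_, ?_⟩
    · rw [← Int.not_even_iff_odd]
      tauto
    · tauto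
  · rintro ⟨hN, h4, h9⟩
    have h : (∃ k, m = 1 + 6 * k) ∨ (∃ k, m = -1 - 6 * k) ∨ (∃ k, m = -8 - 12 * k) ∨
        (∃ k, m = 8 + 12 * k) ∨ (∃ k, m = -9 - 18 * k) ∨ ∃ k, m = 36 * k := by
      -- The cases are `m` prime to 6 (two classes), divisible by 4 but not 3 (two classes), odd and
      -- divisible by 9, and divisible by 36.
      have h : m % 6 = 1 ∨ m % 6 = 5 ∨ m % 12 = 4 ∨ m % 12 = 8 ∨ m % 18 = 9 ∨ m % 36 = 0 := by
        rw [Int.odd_iff] at h4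
        omega
      rcases h with h | h | h | h | h | h
      · exact .inl ⟨(m - 1) / 6, by omega⟩
      · exact .inr (.inl ⟨(-1 - m) / 6, by omega⟩)
      · exact .inr (.inr (.inl ⟨(-8 - m) / 12, by omega⟩))
      · exact .inr (.inr (.inr (.inl ⟨(m - 8) / 12, by omega⟩)))
      · exact .inr (.inr (.inr (.inr (.inl ⟨(-9 - m) / 18, by omega⟩))))
      · exact .inr (.inr (.inr (.inr (.inr ⟨m / 36, by omega⟩))))
    rcases h with ⟨k, rfl⟩ | ⟨k, rfl⟩ | ⟨k, rfl⟩ | ⟨k, rfl⟩ | ⟨k, rfl⟩ | ⟨k, rfl⟩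
    · exact isDetPair_one_add k N hN
    · exact isDetPair_neg_one_sub k N hN
    · exact isDetPair_neg_eight_sub k N hN
    · exact isDetPair_eight_add k N hN
    · exact isDetPair_neg_nine_sub k N hN
    · exact isDetPair_thirtysix_mul k N hN

theorem mem_integerGroupDets_GA_seven_iff (D : ℤ) :
    D ∈ integerGroupDets (GA 7) ↔ ∃ m N : ℤ, D = m * N ^ 6 ∧ IsDetPair m N := by
  refine (mem_integerGroupDets_GA_iff (p := 7) D).trans ⟨?_, ?_⟩
  · rintro ⟨c, rfl⟩
    exact ⟨_, _, rfl, c, rfl, rfl⟩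
  · rintro ⟨_, _, rfl, c, rfl, rfl⟩
    exact ⟨c, rfl⟩

end Main

theorem mainTheorem3 :
    integerGroupDets (GA 7) =
      {D : ℤ | ∃ m l : ℤ, D = m * (m + 7 * l) ^ 6 ∧
        (Odd m ∨ 4 ∣ m) ∧ (¬ 3 ∣ m ∨ 9 ∣ m)} := by
  ext D
  rw [mem_integerGroupDets_GA_seven_iff, Set.mem_ofPred_eq]
  simp only [isDetPair_iff]
  constructor
  · rintro ⟨m, N, rfl, hN, h⟩
    obtain ⟨l, hl⟩ := hN.dvd
    refine ⟨m, l, ?_, h⟩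
    rw [← hl, add_sub_cancel]
  · rintro ⟨m, l, rfl, h⟩
    exact ⟨m, m + 7 * l, rfl, Int.modEq_iff_dvd.mpr ⟨l, by ring⟩, h⟩
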